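/- Let $\mathbb H=\{z\in\mathbb C:\operatorname{Im}z>0\}$ and $d(z,w)=\left|\frac{w-z}{w-\overline z}\right|$. Let $\phi:\mathbb H\to\mathbb H$ be analytic and of parabolic type with Denjoy–Wolff point $\infty$, that is, $\phi(z)\to\infty$ and $\phi(z)/z\to1$ as $z\to\infty$ non-tangentially (i.e. within each sector $|\operatorname{Arg}z-\pi/2|<\theta$, $0<\theta<\pi/2$). Let $w_n=x_n+iy_n\in\mathbb H$, $n\ge 0$, be a backward-iteration sequence with bounded steps for $\phi$: $\phi(w_{n+1})=w_n$ for all $n$, and $\sup_n d(w_n,w_{n+1})<1$. Assume that $y_n\to\ell_\infty$ for some $\ell_\infty>0$ and that $x_n\to+\infty$. Put $a=\sup_n d(w_n,w_{n+1})$ (by Schwarz–Pick the steps increase to $a$), $b_0=2a/\sqrt{1-a^2}$, $\tau_n(z)=x_n+y_nz$, and let $\phi_n$ be the $n$-th iterate of $\phi$. Then the maps $\phi_n\circ\tau_n$ converge, uniformly on compact subsets of $\mathbb H$, to an analytic map $\psi:\mathbb H\to\mathbb H$ with $\psi(z-b_0)=\phi(\psi(z))$ for all $z\in\mathbb H$,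 and, with $Q(R)=\{x+iy: x>R,\ y>1\}$, the map $\psi$ is one-to-one on $Q(R)$ for all sufficiently large $R$. Moreover $\phi$ is one-to-one on $Q(R)$ for all sufficiently large $R$. -/

import Mathlib

open Filter Topology Set Bornology

noncomputable section

/-- The open upper half-plane, as a subset of the complex plane. -/
def upperHalf : Set ℂ := {z | 0 < z.im}

/-- The pseudo-hyperbolic distance `|(w - z) / (w - conj z)|` of the upper half-plane. -/
def pseudoHypDist (z w : ℂ) : ℝ := ‖(w - z) / (w - (starRingEnd ℂ) z)‖

/-- Tending to infinity inside the sector `|Arg z - π / 2| < θ`. -/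
def sectorAtInfty (θ : ℝ) : Filter ℂ :=
  cobounded ℂ ⊓ 𝓟 {z : ℂ | |z.arg - Real.pi / 2| < θ}

/-- `f z` tends to `l` as `z` tends to infinity non-tangentially in the upper half-plane. -/
def NonTangentialTendsto (f : ℂ → ℂ) (l : Filter ℂ) : Prop :=
  ∀ θ : ℝ, 0 < θ → θ < Real.pi / 2 → Tendsto f (sectorAtInfty θ) l

/-- `φ` is an analytic self-map of the upper half-plane of parabolic type, with Denjoy-Wolff
point infinity: `φ z → ∞` and `φ z / z → 1` as `z → ∞` non-tangentially. -/
structure IsParabolicSelfMap (φ : ℂ → ℂ) : Prop where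
  analytic : DifferentiableOn ℂ φ upperHalf
  mapsTo : MapsTo φ upperHalf upperHalf
  tendsto_infty : NonTangentialTendsto φ (cobounded ℂ)
  tendsto_ratio : NonTangentialTendsto (fun z => φ z / z) (𝓝 1)

/-- A backward-iteration sequence with bounded (pseudo-hyperbolic) steps for `φ`. -/
structure IsBISBS (φ : ℂ → ℂ) (w : ℕ → ℂ) : Prop where
  mem : ∀ n, w n ∈ upperHalf
  backward : ∀ n, φ (w (n + 1)) = w n
  bounded_steps : ∃ a : ℝ, a < 1 ∧ ∀ n, pseudoHypDist (w n) (w (n + 1)) ≤ a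

/-- The number `a` for which the steps `d (w n) (w (n + 1))` increase to `a`.
The steps of a backward-iteration sequence increase (Schwarz-Pick), so it is their supremum. -/
def stepLimit (w : ℕ → ℂ) : ℝ := ⨆ n, pseudoHypDist (w n) (w (n + 1))

/-- The translation length `b₀ = 2 a / √(1 - a ^ 2)`. -/
def translationLength (w : ℕ → ℂ) : ℝ :=
  2 * stepLimit w / Real.sqrt (1 - stepLimit w ^ 2)

/-- The automorphism `τ z = x + y z` attached to the point `p = x + i y`. -/
def normalizer (p : ℂ) (z : ℂ) : ℂ := (p.re : ℂ) + (p.im : ℂ) * z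

/-- `ψ` is the conjugating map of `φ` along `w`: the analytic self-map of the upper half-plane
that is the limit, uniformly on compact sets, of the normalized iterates `φ_n ∘ τ_n`, and which
satisfies `ψ (z - b₀) = φ (ψ z)`. -/
structure IsConjugatingMap (φ : ℂ → ℂ) (w : ℕ → ℂ) (ψ : ℂ → ℂ) : Prop where
  analytic : DifferentiableOn ℂ ψ upperHalf
  mapsTo : MapsTo ψ upperHalf upperHalf
  limit : TendstoLocallyUniformlyOn (fun (n : ℕ) (z : ℂ) => φ^[n] (normalizer (w n) z)) ψ
    atTop upperHalf
  conj : ∀ z ∈ upperHalf, ψ (z - (translationLength w : ℂ)) = φ (ψ z)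

/-- The quadrant `Q(R) = {x + i y : x > R, y > 1}`. -/
def quadrant (R : ℝ) : Set ℂ := {z | R < z.re ∧ 1 < z.im}

end

/-! Everything rests on the Schwarz–Pick inequality `schwarz_pick`, for maps into the closed
half-plane, and on Julia's lemma `IsParabolicSelfMap.im_le_im`: `φ` never lowers the imaginary part.

Steps: one-step and two-step hyperbolic distances along `w` are both monotone. Their limits force
consecutive horizontal steps to share a sign eventually, so `x_{n+1} - x_n → b₀ ℓ` with `b₀ > 0`
(`IsBISBS.tendsto_re_step`).

Convergence: with `ψ_n = φ_n ∘ τ_n` and `m ≥ n`, one has `ψ_m = ψ_n ∘ G`, where `G = τ_n⁻¹ ∘ φ_{m-n}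
∘ τ_m` fixes `i` and sends `q_m = τ_m⁻¹ (w_{m+1})` to `q_n`. Since `q_n → b₀ + i ≠ i`, `G` nearly
fixes a second point, hence is nearly the identity by a quantitative Schwarz lemma; so `ψ_n` is
locally uniformly Cauchy.

Injectivity: `ψ z - ℓ z` and `φ z - z` have nonnegative imaginary part, tending to zero along a
sequence going right at bounded height. Harnack makes it smaller than `c * z.im` on `Q(R)`, with `c
= ℓ` or `c = 1`; a collision of values would then violate Schwarz–Pick
(`eventually_injOn_quadrant`). -/

/-! ### Cayley transforms between half-plane and disc -/

lemma upperHalf_isOpen : IsOpen upperHalf := isOpen_lt continuous_const Complex.continuous_im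

lemma norm_sub_conj_sq (p z : ℂ) :
    ‖z - (starRingEnd ℂ) p‖ ^ 2 = ‖z - p‖ ^ 2 + 4 * (z.im * p.im) := by
  simp only [Complex.sq_norm, Complex.normSq_apply, Complex.sub_re, Complex.sub_im,
    Complex.conj_re, Complex.conj_im]
  ring

/-- The Cayley transform sending the point `p` of the upper half-plane to the centre of the
unit disc. -/
noncomputable def cayley (p z : ℂ) : ℂ := (z - p) / (z - (starRingEnd ℂ) p)

/-- The inverse of the Cayley transform `cayley p`. -/
noncomputable def cayleyInv (p ζ : ℂ) : ℂ := (p - (starRingEnd ℂ) p * ζ) / (1 - ζ)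

lemma sub_conj_ne_zero {p z : ℂ} (hp : 0 < p.im) (hz : 0 < z.im) :
    z - (starRingEnd ℂ) p ≠ 0 := by
  intro h
  have := congrArg Complex.im h
  simp at this
  linarith

lemma norm_cayley_sq {p z : ℂ} :
    ‖cayley p z‖ ^ 2 = ‖z - p‖ ^ 2 / (‖z - p‖ ^ 2 + 4 * (z.im * p.im)) := by
  rw [cayley, norm_div, div_pow, norm_sub_conj_sq]

lemma norm_cayley_lt_one {p z : ℂ} (hp : 0 < p.im) (hz : 0 < z.im) : ‖cayley p z‖ < 1 := by
  have h : ‖cayley p z‖ ^ 2 < 1 := by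
    rw [norm_cayley_sq, div_lt_one (by positivity)]
    have := mul_pos hz hp
    linarith
  exact lt_of_pow_lt_pow_left₀ 2 zero_le_one (by simpa using h)

lemma one_sub_ne_zero_of_norm_lt {ζ : ℂ} (h : ‖ζ‖ < 1) : 1 - ζ ≠ 0 := by
  intro h0
  rw [sub_eq_zero] at h0
  simp [← h0] at h

lemma cayleyInv_im (p ζ : ℂ) :
    (cayleyInv p ζ).im = p.im * (1 - ‖ζ‖ ^ 2) / ‖1 - ζ‖ ^ 2 := by
  rw [cayleyInv, Complex.div_im, Complex.sq_norm, Complex.sq_norm, ← sub_div]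
  congr 1
  simp [Complex.normSq_apply]
  ring

lemma cayleyInv_im_pos {p ζ : ℂ} (hp : 0 < p.im) (hζ : ‖ζ‖ < 1) : 0 < (cayleyInv p ζ).im := by
  rw [cayleyInv_im]
  have h1 : 0 < ‖1 - ζ‖ := norm_pos_iff.2 (one_sub_ne_zero_of_norm_lt hζ)
  have h2 : 0 < 1 - ‖ζ‖ ^ 2 := by nlinarith [norm_nonneg ζ]
  positivity

lemma cayleyInv_cayley {p z : ℂ} (hp : 0 < p.im) (hz : 0 < z.im) :
    cayleyInv p (cayley p z) = z := by
  have h1 := one_sub_ne_zero_of_norm_lt (norm_cayley_lt_one hp hz)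
  have h2 := sub_conj_ne_zero hp hz
  rw [cayleyInv, div_eq_iff h1]
  unfold cayley
  field_simp
  ring

lemma differentiableOn_cayley {p : ℂ} (hp : 0 < p.im) :
    DifferentiableOn ℂ (cayley p) upperHalf :=
  (differentiableOn_id.sub_const p).div (differentiableOn_id.sub_const _)
    fun _ hz => sub_conj_ne_zero hp hz

lemma differentiableOn_cayleyInv (p : ℂ) :
    DifferentiableOn ℂ (cayleyInv p) (Metric.ball 0 1) :=
  ((differentiableOn_const _).sub ((differentiableOn_const _).mul differentiableOn_id)).div
    ((differentiableOn_const _).sub differentiableOn_id)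
    fun _ hz => one_sub_ne_zero_of_norm_lt (mem_ball_zero_iff.1 hz)

/-- A self-map of the upper half-plane, read in the unit disc so that it fixes the centre. -/
noncomputable def discConjugate (f : ℂ → ℂ) (p : ℂ) : ℂ → ℂ :=
  fun ζ => cayley (f p) (f (cayleyInv p ζ))

section discConjugate

variable {f : ℂ → ℂ} {p : ℂ}

lemma differentiableOn_discConjugate (hf : DifferentiableOn ℂ f upperHalf)
    (hm : MapsTo f upperHalf upperHalf) (hp : p ∈ upperHalf) :
    DifferentiableOn ℂ (discConjugate f p) (Metric.ball 0 1) := by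
  have h1 : MapsTo (cayleyInv p) (Metric.ball 0 1) upperHalf :=
    fun ζ hζ => cayleyInv_im_pos hp (mem_ball_zero_iff.1 hζ)
  exact (differentiableOn_cayley (hm hp)).comp
    (hf.comp (differentiableOn_cayleyInv p) h1) (hm.comp h1)

lemma mapsTo_discConjugate (hm : MapsTo f upperHalf upperHalf) (hp : p ∈ upperHalf) :
    MapsTo (discConjugate f p) (Metric.ball 0 1) (Metric.closedBall 0 1) := fun _ hζ =>
  mem_closedBall_zero_iff.2
    (norm_cayley_lt_one (hm hp) (hm (cayleyInv_im_pos hp (mem_ball_zero_iff.1 hζ)))).le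

lemma discConjugate_zero : discConjugate f p 0 = 0 := by
  simp [discConjugate, cayley, cayleyInv]

lemma discConjugate_cayley (hp : p ∈ upperHalf) {z : ℂ} (hz : z ∈ upperHalf) :
    discConjugate f p (cayley p z) = cayley (f p) (f z) := by
  rw [discConjugate, cayleyInv_cayley hp hz]

end discConjugate

/-! ### Schwarz–Pick and Harnack inequalities -/

/-- The Schwarz-Pick lemma: a self-map of the upper half-plane contracts the pseudo-hyperbolic
distance. -/
theorem pseudoHypDist_map_le {f : ℂ → ℂ} (hf : DifferentiableOn ℂ f upperHalf)
    (hm : MapsTo f upperHalf upperHalf) {z w : ℂ} (hz : z ∈ upperHalf) (hw : w ∈ upperHalf) :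
    pseudoHypDist (f z) (f w) ≤ pseudoHypDist z w := by
  have h := Complex.norm_le_norm_of_mapsTo_ball (differentiableOn_discConjugate hf hm hz)
    (mapsTo_discConjugate hm hz) discConjugate_zero (norm_cayley_lt_one hz hw)
  rwa [discConjugate_cayley hz hw] at h

lemma pseudoHypDist_sq (z w : ℂ) :
    pseudoHypDist z w ^ 2 = ‖w - z‖ ^ 2 / (‖w - z‖ ^ 2 + 4 * (w.im * z.im)) :=
  norm_cayley_sq

/-- The Schwarz-Pick inequality for self-maps of the upper half-plane. -/
theorem schwarz_pick_of_mapsTo {f : ℂ → ℂ} (hf : DifferentiableOn ℂ f upperHalf)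
    (hm : MapsTo f upperHalf upperHalf) {z w : ℂ} (hz : z ∈ upperHalf) (hw : w ∈ upperHalf) :
    ‖f z - f w‖ ^ 2 * (z.im * w.im) ≤ ‖z - w‖ ^ 2 * ((f z).im * (f w).im) := by
  have hz' : 0 < z.im := hz
  have hw' : 0 < w.im := hw
  have hfz : 0 < (f z).im := hm hz
  have hfw : 0 < (f w).im := hm hw
  have h2 := pow_le_pow_left₀ (show 0 ≤ pseudoHypDist (f w) (f z) from norm_nonneg _)
    (pseudoHypDist_map_le hf hm hw hz) 2
  rw [pseudoHypDist_sq, pseudoHypDist_sq, div_le_div_iff₀ (by positivity) (by positivity)] at h2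
  linarith

/-- The Schwarz-Pick inequality for maps of the upper half-plane into its closure. -/
theorem schwarz_pick {f : ℂ → ℂ} (hf : DifferentiableOn ℂ f upperHalf)
    (hm : ∀ z ∈ upperHalf, 0 ≤ (f z).im) {z w : ℂ} (hz : z ∈ upperHalf) (hw : w ∈ upperHalf) :
    ‖f z - f w‖ ^ 2 * (z.im * w.im) ≤ ‖z - w‖ ^ 2 * ((f z).im * (f w).im) := by
  -- Adding `iε` pushes the values into the open half-plane; then `ε → 0`.
  have key : ∀ ε : ℝ, 0 < ε → ‖f z - f w‖ ^ 2 * (z.im * w.im) ≤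
      ‖z - w‖ ^ 2 * (((f z).im + ε) * ((f w).im + ε)) := by
    intro ε hε
    have := schwarz_pick_of_mapsTo (f := fun z => f z + ε * Complex.I) (hf.add_const _)
      (fun x hx => by
        have := hm x hx
        show 0 < (f x + ε * Complex.I).im
        simp
        linarith) hz hw
    simpa using this
  have hc : Continuous fun ε : ℝ => ‖z - w‖ ^ 2 * (((f z).im + ε) * ((f w).im + ε)) := by fun_prop
  have ht : Tendsto (fun ε : ℝ => ‖z - w‖ ^ 2 * (((f z).im + ε) * ((f w).im + ε))) (𝓝[>] 0)
      (𝓝 (‖z - w‖ ^ 2 * ((f z).im * (f w).im))) := by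
    have := hc.tendsto 0
    simp only [add_zero] at this
    exact this.mono_left nhdsWithin_le_nhds
  exact ge_of_tendsto ht (eventually_nhdsWithin_of_forall fun ε hε => key ε hε)

/-- Harnack's inequality for the imaginary part. -/
theorem im_le_of_schwarz_pick {f : ℂ → ℂ} (hf : DifferentiableOn ℂ f upperHalf)
    (hm : ∀ z ∈ upperHalf, 0 ≤ (f z).im) {z w : ℂ} (hz : z ∈ upperHalf) (hw : w ∈ upperHalf) :
    (f z).im ≤ (2 + ‖z - w‖ ^ 2 / (z.im * w.im)) * (f w).im := by
  have hz' : 0 < z.im := hz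
  have hw' : 0 < w.im := hw
  have h := schwarz_pick hf hm hz hw
  have h0 : ((f z).im - (f w).im) ^ 2 ≤ ‖f z - f w‖ ^ 2 := by
    rw [← Complex.sub_im, ← sq_abs]
    exact pow_le_pow_left₀ (abs_nonneg _) (Complex.abs_im_le_norm _) 2
  set s := ‖z - w‖ ^ 2 / (z.im * w.im) with hs
  have hs' : ‖z - w‖ ^ 2 = s * (z.im * w.im) := by rw [hs]; field_simp
  have hs0 : 0 ≤ s := by positivity
  have hP : 0 < z.im * w.im := by positivity
  rw [hs'] at h
  have h1 : ‖f z - f w‖ ^ 2 ≤ s * ((f z).im * (f w).im) :=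
    le_of_mul_le_mul_right (by linarith) hP
  have ha := hm z hz
  have hb := hm w hw
  by_contra! hlt
  have hpos : 0 < (f z).im := lt_of_le_of_lt (by positivity) hlt
  -- With `u`, `v` the two imaginary parts, `(u - v)² ≤ s u v` gives `u² + v² ≤ (2 + s) u v < u²`.
  nlinarith [mul_lt_mul_of_pos_left hlt hpos, sq_nonneg (f w).im]

/-- Along a vertical half-line, the imaginary part grows at most linearly. -/
theorem im_div_im_antitone {f : ℂ → ℂ} (hf : DifferentiableOn ℂ f upperHalf)
    (hm : ∀ z ∈ upperHalf, 0 ≤ (f z).im) {z w : ℂ} (hw : w ∈ upperHalf)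
    (hre : z.re = w.re) (him : w.im ≤ z.im) :
    (f z).im * w.im ≤ (f w).im * z.im := by
  have hw' : 0 < w.im := hw
  have hz' : 0 < z.im := hw'.trans_le him
  have h := schwarz_pick hf hm (z := z) hz' hw
  have h0 : ((f z).im - (f w).im) ^ 2 ≤ ‖f z - f w‖ ^ 2 := by
    rw [← Complex.sub_im, ← sq_abs]
    exact pow_le_pow_left₀ (abs_nonneg _) (Complex.abs_im_le_norm _) 2
  have h1 : ‖z - w‖ ^ 2 = (z.im - w.im) ^ 2 := by
    rw [Complex.sq_norm, Complex.normSq_apply]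
    simp [hre]
    ring
  rw [h1] at h
  have h2 := (mul_le_mul_of_nonneg_right h0 (mul_pos hz' hw').le).trans h
  have ha := hm z hz'
  have hb := hm w hw
  by_contra! hlt
  -- Schwarz–Pick on a vertical line factors into this product; if the claim failed, both factors
  -- would be positive.
  have h3 : ((f z).im * w.im - (f w).im * z.im) * ((f z).im * z.im - (f w).im * w.im) ≤ 0 := by
    linarith
  have h4 : (f w).im * w.im ≤ (f w).im * z.im := by gcongr
  have hpos : 0 < (f z).im := by
    by_contra! h5
    have : (f z).im = 0 := le_antisymm h5 ha
    rw [this] at hlt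
    nlinarith [mul_nonneg hb hz'.le]
  have h5 : (f z).im * w.im ≤ (f z).im * z.im := by gcongr
  nlinarith

/-! ### Injectivity criterion on quadrants -/

/-- A map `z ↦ c z + p z`, with `Im p ≥ 0` and `Im p` tending to zero along a sequence tending to
infinity with bounded steps near a horizontal line, is injective far out in the quadrant. -/
theorem eventually_injOn_quadrant {f p : ℂ → ℂ} {c : ℝ} (hc : 0 < c)
    (hfp : ∀ z ∈ upperHalf, f z = c * z + p z) (hp : DifferentiableOn ℂ p upperHalf)
    (hm : ∀ z ∈ upperHalf, 0 ≤ (p z).im) {u : ℕ → ℂ} (hu : ∀ n, u n ∈ upperHalf) {ℓ B : ℝ}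
    (hℓ : 0 < ℓ) (him : Tendsto (fun n => (u n).im) atTop (𝓝 ℓ))
    (hre : Tendsto (fun n => (u n).re) atTop atTop)
    (hB : ∀ n, |(u (n + 1)).re - (u n).re| ≤ B)
    (hpu : Tendsto (fun n => (p (u n)).im) atTop (𝓝 0)) :
    ∀ᶠ R : ℝ in atTop, InjOn f (quadrant R) := by
  have hB0 : 0 ≤ B := (abs_nonneg _).trans (hB 0)
  -- The Harnack constant between a point at height `1` and a `u k` whose height lies in `(ℓ/2, 2ℓ)`
  -- and whose abscissa is within `B`.
  set M : ℝ := 2 + (B ^ 2 + (1 + 2 * ℓ) ^ 2) / (ℓ / 2) with hM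
  have hM0 : 0 < M := by positivity
  have e1 : ∀ᶠ n in atTop, (p (u n)).im < c / M := hpu.eventually (gt_mem_nhds (by positivity))
  have e2 : ∀ᶠ n in atTop, (u n).im < 2 * ℓ := him.eventually (gt_mem_nhds (by linarith))
  have e3 : ∀ᶠ n in atTop, ℓ / 2 < (u n).im := him.eventually (lt_mem_nhds (by linarith))
  obtain ⟨N, hN⟩ := eventually_atTop.1 (e1.and (e2.and e3))
  have hsmall : ∀ z : ℂ, (u N).re ≤ z.re → 1 < z.im → (p z).im < c * z.im := by
    intro z hz hz1
    obtain ⟨k, hkN, hk1, hk2⟩ : ∃ k, N ≤ k ∧ (u k).re ≤ z.re ∧ z.re < (u (k + 1)).re := by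
      by_contra! hcon
      have hle : ∀ k, N ≤ k → (u k).re ≤ z.re := by
        intro k hk
        induction k, hk using Nat.le_induction with
        | base => exact hz
        | succ k hk ih => exact hcon k hk ih
      obtain ⟨n, hn1, hn2⟩ := ((hre.eventually_gt_atTop z.re).and (eventually_ge_atTop N)).exists
      exact absurd (hle n hn2) (not_le.2 hn1)
    obtain ⟨h1, h2, h3⟩ := hN k hkN
    -- Descend vertically from `z` to height `1`, then compare with `u k` by Harnack.
    set v : ℂ := ⟨z.re, 1⟩
    have hv : v ∈ upperHalf := (one_pos : (0 : ℝ) < 1)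
    have hanti := im_div_im_antitone hp hm (z := z) hv rfl hz1.le
    have hharn := im_le_of_schwarz_pick hp hm hv (hu k)
    have hd : ‖v - u k‖ ^ 2 ≤ B ^ 2 + (1 + 2 * ℓ) ^ 2 := by
      rw [Complex.sq_norm, Complex.normSq_apply]
      have hx : |(v - u k).re| ≤ B := by
        have := (le_abs_self _).trans (hB k)
        rw [Complex.sub_re, abs_le]
        constructor <;> simp only [v] <;> linarith
      have hy : |(v - u k).im| ≤ 1 + 2 * ℓ := by
        rw [Complex.sub_im, abs_le]
        constructor <;> simp only [v] <;> linarith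
      rw [← sq, ← sq, ← sq_abs (v - u k).re, ← sq_abs (v - u k).im]
      gcongr
    have hv1 : v.im = 1 := rfl
    have hfac : 2 + ‖v - u k‖ ^ 2 / (v.im * (u k).im) ≤ M := by
      rw [hM, hv1, one_mul]
      gcongr
    have hpv : (p v).im < c := by
      calc (p v).im ≤ _ := hharn
        _ ≤ M * (p (u k)).im := mul_le_mul_of_nonneg_right hfac (hm _ (hu k))
        _ < M * (c / M) := by gcongr
        _ = c := by field_simp
    rw [hv1, mul_one] at hanti
    exact hanti.trans_lt (by gcongr)
  filter_upwards [eventually_ge_atTop (u N).re] with R hR z hz w hw hzw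
  have hz' : z ∈ upperHalf := one_pos.trans hz.2
  have hw' : w ∈ upperHalf := one_pos.trans hw.2
  have hz0 : 0 < z.im := hz'
  have hw0 : 0 < w.im := hw'
  by_contra hne
  have hd : 0 < ‖z - w‖ := norm_pos_iff.2 (sub_ne_zero.2 hne)
  rw [hfp z hz', hfp w hw'] at hzw
  -- Equal values of `f` make `p` expand the distance by exactly `c`, so Schwarz–Pick gives `c² z.im
  -- w.im ≤ (p z).im (p w).im`, against `hsmall`.
  have heq : ‖p z - p w‖ = c * ‖z - w‖ := by
    have : p z - p w = -(c * (z - w)) := by linear_combination hzw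
    rw [this, norm_neg, norm_mul, Complex.norm_real, Real.norm_of_nonneg hc.le]
  have h := schwarz_pick hp hm hz' hw'
  rw [heq] at h
  have h1 := hsmall z (hR.trans hz.1.le) hz.2
  have h2 := hsmall w (hR.trans hw.1.le) hw.2
  have h3 : (p z).im * (p w).im < (c * z.im) * (c * w.im) :=
    mul_lt_mul'' h1 h2 (hm z hz') (hm w hw')
  have h4 := mul_lt_mul_of_pos_left h3 (pow_pos hd 2)
  nlinarith

/-! ### Julia's lemma -/

lemma tendsto_mul_I_sectorAtInfty {θ : ℝ} (hθ : 0 < θ) :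
    Tendsto (fun t : ℝ => (t : ℂ) * Complex.I) atTop (sectorAtInfty θ) := by
  refine tendsto_inf.2 ⟨?_, tendsto_principal.2 ?_⟩
  · rw [← tendsto_norm_atTop_iff_cobounded]
    simpa using tendsto_abs_atTop_atTop
  · filter_upwards [eventually_gt_atTop 0] with t ht
    simp [Complex.arg_real_mul _ ht, hθ]

/-- Julia's lemma at infinity, for a map with angular derivative one there. -/
theorem IsParabolicSelfMap.im_le_im {φ : ℂ → ℂ} (hφ : IsParabolicSelfMap φ) {z : ℂ}
    (hz : z ∈ upperHalf) : z.im ≤ (φ z).im := by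
  have hr : Tendsto (fun t : ℝ => φ (t * Complex.I) / (t * Complex.I)) atTop (𝓝 1) :=
    (hφ.tendsto_ratio (Real.pi / 4) (by positivity) (by linarith [Real.pi_pos])).comp
      (tendsto_mul_I_sectorAtInfty (by positivity))
  have hinv : Tendsto (fun t : ℝ => ((t : ℂ))⁻¹) atTop (𝓝 0) := by
    have := (Complex.continuous_ofReal.tendsto 0).comp tendsto_inv_atTop_zero
    simpa [Function.comp_def] using this
  -- These are the two sides of Schwarz–Pick for `z` and `it`, divided by `t³`; as `t → ∞` they tend
  -- to `z.im` and `(φ z).im`.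
  have hl : Tendsto (fun t : ℝ => ‖φ z * (t : ℂ)⁻¹ -
      φ (t * Complex.I) / (t * Complex.I) * Complex.I‖ ^ 2 * z.im) atTop
      (𝓝 (‖φ z * 0 - 1 * Complex.I‖ ^ 2 * z.im)) :=
    ((((hinv.const_mul _).sub (hr.mul_const _)).norm.pow 2).mul_const _)
  have hrhs : Tendsto (fun t : ℝ => ‖z * (t : ℂ)⁻¹ - Complex.I‖ ^ 2 *
      ((φ z).im * (φ (t * Complex.I) / (t * Complex.I)).re)) atTop
      (𝓝 (‖z * 0 - Complex.I‖ ^ 2 * ((φ z).im * (1 : ℂ).re))) :=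
    (((hinv.const_mul _).sub_const _).norm.pow 2).mul
      (((Complex.continuous_re.tendsto _).comp hr).const_mul _)
  have hle := le_of_tendsto_of_tendsto hl hrhs (by
    filter_upwards [eventually_gt_atTop 0] with t ht
    have htI : (t : ℂ) * Complex.I ∈ upperHalf := by simpa [upperHalf] using ht
    have ht0 : (t : ℂ) ≠ 0 := by exact_mod_cast ht.ne'
    have h := schwarz_pick_of_mapsTo hφ.analytic hφ.mapsTo hz htI
    set r := φ (t * Complex.I) / (t * Complex.I) with hrdef
    have hφt : φ (t * Complex.I) = r * (t * Complex.I) := by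
      rw [hrdef, div_mul_cancel₀]
      exact mul_ne_zero ht0 Complex.I_ne_zero
    have e1 : ‖φ z - φ (t * Complex.I)‖ = ‖φ z * (t : ℂ)⁻¹ - r * Complex.I‖ * t := by
      rw [hφt]
      nth_rewrite 3 [← Real.norm_of_nonneg ht.le]
      rw [← Complex.norm_real, ← norm_mul]
      congr 1
      field_simp
    have e2 : ‖z - t * Complex.I‖ = ‖z * (t : ℂ)⁻¹ - Complex.I‖ * t := by
      nth_rewrite 3 [← Real.norm_of_nonneg ht.le]
      rw [← Complex.norm_real, ← norm_mul]
      congr 1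
      field_simp
    have e3 : (φ (t * Complex.I)).im = r.re * t := by
      rw [hφt]; simp
    have e4 : ((t : ℂ) * Complex.I).im = t := by simp
    rw [e1, e2, e3, e4] at h
    have ht3 : 0 < t ^ 3 := by positivity
    refine le_of_mul_le_mul_right ?_ ht3
    calc _ = _ := by ring
      _ ≤ _ := h
      _ = _ := by ring)
  simpa using hle

/-! ### Near-identity maps and locally uniform convergence -/

/-- Quantitative Schwarz lemma: a self-map of the upper half-plane fixing `i` which barely moves
another point `q` (in the Cayley coordinate) barely moves any point. -/
theorem norm_cayley_sub_le {G : ℂ → ℂ} (hG : DifferentiableOn ℂ G upperHalf)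
    (hm : MapsTo G upperHalf upperHalf) (hI : G Complex.I = Complex.I) {q z : ℂ}
    (hq : q ∈ upperHalf) (hqI : q ≠ Complex.I) (hz : z ∈ upperHalf) :
    ‖cayley Complex.I (G z) - cayley Complex.I z‖ ≤
      ‖cayley Complex.I (G q) - cayley Complex.I q‖ / ‖cayley Complex.I q‖ +
        √(2 * (‖cayley Complex.I (G q) - cayley Complex.I q‖ / ‖cayley Complex.I q‖) *
          (‖z - q‖ ^ 2 / (z.im * q.im))) := by
  have hIm : Complex.I ∈ upperHalf := by simp [upperHalf]
  have hz' : 0 < z.im := hz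
  have hq' : 0 < q.im := hq
  have hFd := differentiableOn_discConjugate hG hm hIm
  have hFm : MapsTo (discConjugate G Complex.I) (Metric.ball 0 1)
      (Metric.closedBall (discConjugate G Complex.I 0) 1) := by
    rw [discConjugate_zero]
    exact mapsTo_discConjugate hm hIm
  -- `h ζ` is the Schwarz quotient `F ζ / ζ` of the disc form of `G`, so `‖h‖ ≤ 1`. Below, `p = i (1
  -- - h)` maps into the closed half-plane and measures relative displacement; Schwarz–Pick carries
  -- its smallness from `q` to `z`.
  set h : ℂ → ℂ := dslope (discConjugate G Complex.I) 0
  set C := cayley Complex.I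
  have hCm : MapsTo C upperHalf (Metric.ball 0 1) := fun x hx =>
    mem_ball_zero_iff.2 (norm_cayley_lt_one hIm hx)
  have hh : ∀ x ∈ upperHalf, C (G x) = C x * h (C x) := by
    intro x hx
    have h1 := sub_smul_dslope (discConjugate G Complex.I) 0 (C x)
    rw [discConjugate_zero, discConjugate_cayley hIm hx, hI] at h1
    simpa using h1.symm
  have hle : ∀ x ∈ upperHalf, ‖h (C x)‖ ≤ 1 := fun x hx => by
    simpa using Complex.norm_dslope_le_div_of_mapsTo_ball hFd hFm (hCm hx)
  set p : ℂ → ℂ := fun x => Complex.I * (1 - h (C x))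
  have hpd : DifferentiableOn ℂ p upperHalf := by
    have : DifferentiableOn ℂ h (Metric.ball 0 1) :=
      (Complex.differentiableOn_dslope (Metric.ball_mem_nhds _ one_pos)).2 hFd
    exact ((this.comp (differentiableOn_cayley hIm) hCm).const_sub 1).const_mul _
  have hpim : ∀ x, (p x).im = 1 - (h (C x)).re := fun x => by simp [p]
  have hp0 : ∀ x ∈ upperHalf, 0 ≤ (p x).im := fun x hx => by
    rw [hpim]
    linarith [(Complex.re_le_norm (h (C x))).trans (hle x hx)]
  have hp2 : (p z).im ≤ 2 := by
    rw [hpim]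
    linarith [(neg_le_of_abs_le (Complex.abs_re_le_norm (h (C z)))), hle z hz]
  have hpn : ∀ x ∈ upperHalf, ‖C (G x) - C x‖ = ‖C x‖ * ‖p x‖ := by
    intro x hx
    rw [hh x hx, ← norm_neg, ← norm_mul]
    have : -(C x * h (C x) - C x) = -Complex.I * (C x * p x) := by
      simp only [p]
      linear_combination (C x - C x * h (C x)) * Complex.I_mul_I
    rw [this, norm_mul]
    simp
  have hCq : 0 < ‖C q‖ :=
    norm_pos_iff.2 (div_ne_zero (sub_ne_zero.2 hqI) (sub_conj_ne_zero hIm hq))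
  rw [hpn q hq, mul_div_cancel_left₀ _ hCq.ne', hpn z hz]
  have h1 : ‖C z‖ * ‖p z‖ ≤ ‖p z‖ :=
    mul_le_of_le_one_left (norm_nonneg _) (norm_cayley_lt_one hIm hz).le
  refine h1.trans ?_
  have h2 : ‖p z - p q‖ ≤ √(2 * ‖p q‖ * (‖z - q‖ ^ 2 / (z.im * q.im))) := by
    refine Real.le_sqrt_of_sq_le ?_
    have hsp := schwarz_pick hpd hp0 hz hq
    rw [← mul_div_assoc, le_div_iff₀ (by positivity)]
    have h3 : (p z).im * (p q).im ≤ 2 * ‖p q‖ :=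
      mul_le_mul hp2 ((le_abs_self _).trans (Complex.abs_im_le_norm _)) (hp0 q hq) zero_le_two
    nlinarith [mul_le_mul_of_nonneg_left h3 (sq_nonneg ‖z - q‖)]
  calc ‖p z‖ = ‖p q + (p z - p q)‖ := by congr 1; ring
    _ ≤ ‖p q‖ + ‖p z - p q‖ := norm_add_le _ _
    _ ≤ _ := by gcongr

/-- Converts displacement in the disc coordinate into displacement in the half-plane, via `C w - C z
= 2i (w - z) / ((z + i)(w + i))`. -/
lemma norm_sub_sq_eq_cayley {z w : ℂ} (hz : z ∈ upperHalf) (hw : w ∈ upperHalf) :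
    4 * ‖w - z‖ ^ 2 = ‖cayley Complex.I w - cayley Complex.I z‖ ^ 2 *
      (‖z + Complex.I‖ ^ 2 * ‖w + Complex.I‖ ^ 2) := by
  have hIm : (0 : ℝ) < Complex.I.im := by simp
  have h1 := sub_conj_ne_zero hIm hz
  have h2 := sub_conj_ne_zero hIm hw
  rw [Complex.conj_I, sub_neg_eq_add] at h1 h2
  have : 2 * Complex.I * (w - z) = (cayley Complex.I w - cayley Complex.I z) *
      ((z + Complex.I) * (w + Complex.I)) := by
    simp only [cayley, Complex.conj_I, sub_neg_eq_add]
    field_simp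
    ring
  have h3 := congrArg (fun x => ‖x‖ ^ 2) this
  simp only [norm_mul, Complex.norm_I, mul_one, Complex.norm_ofNat, mul_pow] at h3
  rw [← h3]
  ring

/-- If `g` is a self-map of the upper half-plane and `G` a self-map fixing `i`, then `g ∘ G` is
close to `g` where `G` is close to the identity. -/
theorem norm_comp_sub_le {g G : ℂ → ℂ} (hg : DifferentiableOn ℂ g upperHalf)
    (hgm : MapsTo g upperHalf upperHalf) (hG : DifferentiableOn ℂ G upperHalf)
    (hm : MapsTo G upperHalf upperHalf) (hI : G Complex.I = Complex.I) {z : ℂ}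
    (hz : z ∈ upperHalf) :
    ‖g (G z) - g z‖ ≤ ‖cayley Complex.I (G z) - cayley Complex.I z‖ *
      (‖z + Complex.I‖ ^ 2 / z.im * ((2 + ‖z - Complex.I‖ ^ 2 / z.im) * (g Complex.I).im)) := by
  have hIm : Complex.I ∈ upperHalf := by simp [upperHalf]
  have hz' : 0 < z.im := hz
  have hw : 0 < (G z).im := hm hz
  have hgI : 0 < (g Complex.I).im := hgm hIm
  have hgz : 0 < (g z).im := hgm hz
  have hgw : 0 < (g (G z)).im := hgm (hm hz)
  set A := ‖z + Complex.I‖ ^ 2 / z.im with hA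
  -- `Y` bounds both `(g z).im` and `(g (G z)).im` by Harnack from `i`, since `g ∘ G` and `g` agree
  -- there.
  set Y := (2 + ‖z - Complex.I‖ ^ 2 / z.im) * (g Complex.I).im with hY
  have hbound : ∀ f : ℂ → ℂ, DifferentiableOn ℂ f upperHalf → MapsTo f upperHalf upperHalf →
      (f z).im ≤ (2 + ‖z - Complex.I‖ ^ 2 / z.im) * (f Complex.I).im := fun f hf hfm => by
    simpa using im_le_of_schwarz_pick hf (fun x hx => (hfm hx).le) hz hIm
  have hb1 : (g z).im ≤ Y := hbound g hg hgm
  have hb2 : (g (G z)).im ≤ Y := by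
    have := hbound (g ∘ G) (hg.comp hG hm) (hgm.comp hm)
    simpa [hI] using this
  -- Schwarz–Pick against the fixed point `i`. With this bound `(G z).im` cancels at the end, so no
  -- lower bound for it is needed.
  have hAG : ‖G z + Complex.I‖ ^ 2 ≤ A * (G z).im := by
    have h := schwarz_pick_of_mapsTo hG hm hz hIm
    have n1 := norm_sub_conj_sq Complex.I z
    have n2 := norm_sub_conj_sq Complex.I (G z)
    rw [Complex.conj_I, sub_neg_eq_add, Complex.I_im, mul_one] at n1 n2
    rw [hI, Complex.I_im, mul_one, mul_one] at h
    rw [hA, div_mul_eq_mul_div, le_div_iff₀ hz', n1, n2]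
    linarith
  have hAz : ‖z + Complex.I‖ ^ 2 = A * z.im := by rw [hA]; field_simp
  have hA0 : 0 ≤ A := by positivity
  have hY0 : 0 ≤ Y := by positivity
  have hsp := schwarz_pick_of_mapsTo hg hgm (hm hz) hz
  have hc := norm_sub_sq_eq_cayley hz (hm hz)
  set D := ‖cayley Complex.I (G z) - cayley Complex.I z‖
  have hD : ‖G z - z‖ ^ 2 ≤ D ^ 2 * A ^ 2 * (z.im * (G z).im) := by
    have : ‖z + Complex.I‖ ^ 2 * ‖G z + Complex.I‖ ^ 2 ≤ A * z.im * (A * (G z).im) := by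
      rw [hAz]
      gcongr
    nlinarith [mul_le_mul_of_nonneg_left this (sq_nonneg D), sq_nonneg ‖G z - z‖]
  have hfin : ‖g (G z) - g z‖ ^ 2 ≤ (D * (A * Y)) ^ 2 := by
    have hYY : (g (G z)).im * (g z).im ≤ Y * Y := by gcongr
    have h5 : ‖g (G z) - g z‖ ^ 2 * ((G z).im * z.im) ≤
        (D * (A * Y)) ^ 2 * ((G z).im * z.im) := by
      calc _ ≤ _ := hsp
        _ ≤ D ^ 2 * A ^ 2 * (z.im * (G z).im) * (Y * Y) := by gcongr
        _ = _ := by ring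
    exact le_of_mul_le_mul_right h5 (mul_pos hw hz')
  exact le_of_sq_le_sq hfin (by positivity)

/-- A compatible system of self-maps `ψ m = ψ n ∘ G n m`, with `G n m` fixing `i` and moving the
terms of a convergent sequence `q` into each other, converges locally uniformly. -/
theorem exists_tendstoLocallyUniformlyOn {ψ : ℕ → ℂ → ℂ} {G : ℕ → ℕ → ℂ → ℂ} {q : ℕ → ℂ} {q₀ : ℂ}
    (hψ : ∀ n, DifferentiableOn ℂ (ψ n) upperHalf) (hψm : ∀ n, MapsTo (ψ n) upperHalf upperHalf)
    (hG : ∀ n m, n ≤ m → DifferentiableOn ℂ (G n m) upperHalf)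
    (hGm : ∀ n m, n ≤ m → MapsTo (G n m) upperHalf upperHalf)
    (hGI : ∀ n m, n ≤ m → G n m Complex.I = Complex.I)
    (hψG : ∀ n m, n ≤ m → ∀ z ∈ upperHalf, ψ m z = ψ n (G n m z))
    (hGq : ∀ n m, n ≤ m → G n m (q m) = q n)
    (hq : ∀ n, q n ∈ upperHalf) (hq₀ : q₀ ∈ upperHalf) (hqI : q₀ ≠ Complex.I)
    (hlim : Tendsto q atTop (𝓝 q₀)) :
    ∃ ψ' : ℂ → ℂ, TendstoLocallyUniformlyOn ψ ψ' atTop upperHalf := by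
  have hIm : Complex.I ∈ upperHalf := by simp [upperHalf]
  have hψI : ∀ n, ψ n Complex.I = ψ 0 Complex.I := fun n => by
    rw [hψG 0 n n.zero_le _ hIm, hGI 0 n n.zero_le]
  have hcauchy : ∀ K ⊆ upperHalf, IsCompact K → UniformCauchySeqOn ψ atTop K := by
    intro K hKH hK
    -- `A` serves all `n` at once because every `ψ n` has the same value at `i`.
    obtain ⟨A, hA⟩ := hK.exists_bound_of_continuousOn (f := fun z : ℂ =>
      ‖z + Complex.I‖ ^ 2 / z.im *
        ((2 + ‖z - Complex.I‖ ^ 2 / z.im) * (ψ 0 Complex.I).im)) (by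
      have hne : ∀ z ∈ K, z.im ≠ 0 := fun z hz => (hKH hz).ne'
      fun_prop (disch := assumption))
    obtain ⟨Q, hQ, hQc, hQH⟩ := exists_mem_nhds_isCompact_mapsTo (X := ℂ) continuous_id
      (upperHalf_isOpen.mem_nhds hq₀)
    obtain ⟨S, hS⟩ := (hK.prod hQc).exists_bound_of_continuousOn
      (f := fun x : ℂ × ℂ => ‖x.1 - x.2‖ ^ 2 / (x.1.im * x.2.im)) (by
      have hne : ∀ x ∈ K ×ˢ Q, x.1.im * x.2.im ≠ 0 := fun x hx =>
        mul_ne_zero (hKH hx.1).ne' (show 0 < x.2.im from hQH hx.2).ne'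
      fun_prop (disch := assumption))
    have hC : Tendsto (fun n => cayley Complex.I (q n)) atTop (𝓝 (cayley Complex.I q₀)) :=
      (((differentiableOn_cayley hIm).continuousOn).continuousAt
        (upperHalf_isOpen.mem_nhds hq₀)).tendsto.comp hlim
    have hC0 : ‖cayley Complex.I q₀‖ ≠ 0 :=
      norm_ne_zero_iff.2 (div_ne_zero (sub_ne_zero.2 hqI) (sub_conj_ne_zero hIm hq₀))
    -- The relative displacement of `q m` under `G n m`, which moves it to `q n`.
    set η : ℕ × ℕ → ℝ := fun x =>
      ‖cayley Complex.I (q x.1) - cayley Complex.I (q x.2)‖ / ‖cayley Complex.I (q x.2)‖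
    have hη : Tendsto η (atTop ×ˢ atTop) (𝓝 0) := by
      have h1 := hC.comp (tendsto_fst (f := (atTop : Filter ℕ)) (g := (atTop : Filter ℕ)))
      have h2 := hC.comp (tendsto_snd (f := (atTop : Filter ℕ)) (g := (atTop : Filter ℕ)))
      have := (h1.sub h2).norm.div h2.norm hC0
      rw [sub_self, norm_zero, zero_div] at this
      exact this
    have herr : Tendsto (fun x => (η x + √(2 * η x * S)) * A) (atTop ×ˢ atTop) (𝓝 0) := by
      have := (hη.add ((hη.const_mul 2).mul_const S).sqrt).mul_const A
      simpa using this
    have hqQ : ∀ᶠ n in atTop, q n ∈ Q := hlim.eventually_mem hQ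
    have hqne : ∀ᶠ n in atTop, q n ≠ Complex.I := hlim.eventually_ne hqI
    rw [Metric.uniformCauchySeqOn_iff]
    intro ε hε
    have hev := herr.eventually (gt_mem_nhds hε)
    rw [prod_atTop_atTop_eq, eventually_atTop_prod_self'] at hev
    obtain ⟨N₁, hN₁⟩ := hev
    obtain ⟨N₂, hN₂⟩ := eventually_atTop.1 (hqQ.and hqne)
    have key : ∀ n m, n ≤ m → max N₁ N₂ ≤ n → ∀ z ∈ K, dist (ψ m z) (ψ n z) < ε := by
      intro n m hnm hn z hz
      have hm : max N₁ N₂ ≤ m := hn.trans hnm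
      have hzH := hKH hz
      obtain ⟨hmQ, hmI⟩ := hN₂ m (le_of_max_le_right hm)
      have h1 := norm_comp_sub_le (hψ n) (hψm n) (hG n m hnm) (hGm n m hnm) (hGI n m hnm) hzH
      have h2 := norm_cayley_sub_le (hG n m hnm) (hGm n m hnm) (hGI n m hnm) (hq m) hmI hzH
      rw [hGq n m hnm] at h2
      rw [hψI] at h1
      have h3 := (le_abs_self _).trans (hA z hz)
      have h4 := (le_abs_self _).trans (hS (z, q m) ⟨hz, hmQ⟩)
      have hη0 : 0 ≤ η (n, m) := by positivity
      rw [dist_eq_norm, hψG n m hnm z hzH]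
      refine (h1.trans ?_).trans_lt (hN₁ n (le_of_max_le_left hn) m (le_of_max_le_left hm))
      have hA0 : 0 ≤ A := (norm_nonneg _).trans (hA z hz)
      refine (mul_le_mul_of_nonneg_left h3 (norm_nonneg _)).trans
        (mul_le_mul_of_nonneg_right (h2.trans ?_) hA0)
      have : √(2 * η (n, m) * (‖z - q m‖ ^ 2 / (z.im * (q m).im))) ≤ √(2 * η (n, m) * S) :=
        Real.sqrt_le_sqrt (mul_le_mul_of_nonneg_left h4 (by positivity))
      exact add_le_add_right this _
    refine ⟨max N₁ N₂, fun m hm n hn z hz => ?_⟩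
    rcases le_total n m with h | h
    · exact key n m h hn z hz
    · rw [dist_comm]
      exact key m n h hm z hz
  have hpt : ∀ z : ℂ, ∃ l, z ∈ upperHalf → Tendsto (fun n => ψ n z) atTop (𝓝 l) := by
    intro z
    by_cases hz : z ∈ upperHalf
    · obtain ⟨l, hl⟩ := cauchySeq_tendsto_of_complete
        ((hcauchy {z} (singleton_subset_iff.2 hz) isCompact_singleton).cauchySeq rfl)
      exact ⟨l, fun _ => hl⟩
    · exact ⟨0, fun h => absurd h hz⟩
  choose ψ' hψ' using hpt
  refine ⟨ψ', (tendstoLocallyUniformlyOn_iff_forall_isCompact upperHalf_isOpen).2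
    fun K hKH hK => ?_⟩
  exact (hcauchy K hKH hK).tendstoUniformlyOn_of_tendsto fun z hz => hψ' z (hKH hz)

/-! ### Asymptotics of the horizontal steps -/

lemma tendsto_of_sq_of_mul_succ {x s : ℕ → ℝ} {B : ℝ} (hs : ∀ n, s n = x (n + 1) - x n)
    (hx : Tendsto x atTop atTop) (hB : 0 ≤ B) (hsq : Tendsto (fun n => s n ^ 2) atTop (𝓝 (B ^ 2)))
    (hpos : ∀ᶠ n in atTop, 0 < s n * s (n + 1)) : Tendsto s atTop (𝓝 B) := by
  obtain ⟨N, hN⟩ := eventually_atTop.1 hpos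
  -- From `N` on the sign of `s` is constant; a negative sign would bound `x` above.
  have hsN : ∀ n, N ≤ n → 0 < s n := by
    rcases lt_trichotomy (s N) 0 with h | h | h
    · exfalso
      have hneg : ∀ n, N ≤ n → s n < 0 := by
        intro n hn
        induction n, hn using Nat.le_induction with
        | base => exact h
        | succ k hk ih => nlinarith [hN k hk]
      have hle : ∀ n, N ≤ n → x n ≤ x N := by
        intro n hn
        induction n, hn using Nat.le_induction with
        | base => exact le_rfl
        | succ k hk ih => linarith [hneg k hk, hs k]
      obtain ⟨n, h1, h2⟩ := ((hx.eventually_gt_atTop (x N)).and (eventually_ge_atTop N)).exists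
      exact absurd (hle n h2) (not_le.2 h1)
    · have := hN N le_rfl
      simp [h] at this
    · intro n hn
      induction n, hn using Nat.le_induction with
      | base => exact h
      | succ k hk ih => exact (pos_iff_pos_of_mul_pos (hN k hk)).1 ih
  have h1 := hsq.sqrt
  rw [Real.sqrt_sq hB] at h1
  refine h1.congr' ?_
  filter_upwards [eventually_ge_atTop N] with n hn
  exact Real.sqrt_sq (hsN n hn).le

section BackwardIteration

variable {φ : ℂ → ℂ} {w : ℕ → ℂ} {ℓ : ℝ}

lemma IsBISBS.stepLimit_lt_one (hw : IsBISBS φ w) : stepLimit w < 1 := by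
  obtain ⟨a, ha, h⟩ := hw.bounded_steps
  exact (ciSup_le h).trans_lt ha

lemma stepLimit_nonneg : 0 ≤ stepLimit w :=
  Real.iSup_nonneg fun _ => norm_nonneg _

lemma IsBISBS.tendsto_step (hw : IsBISBS φ w) (hφ : IsParabolicSelfMap φ) :
    Tendsto (fun n => pseudoHypDist (w n) (w (n + 1))) atTop (𝓝 (stepLimit w)) := by
  refine tendsto_atTop_ciSup (monotone_nat_of_le_succ fun n => ?_) ?_
  · have := pseudoHypDist_map_le hφ.analytic hφ.mapsTo (hw.mem (n + 1)) (hw.mem (n + 1 + 1))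
    rwa [hw.backward, hw.backward] at this
  · obtain ⟨a, -, h⟩ := hw.bounded_steps
    exact ⟨a, by rintro _ ⟨n, rfl⟩; exact h n⟩

lemma translationLength_sq (hw : IsBISBS φ w) :
    translationLength w ^ 2 = 4 * stepLimit w ^ 2 / (1 - stepLimit w ^ 2) := by
  have h1 := hw.stepLimit_lt_one
  have h0 := stepLimit_nonneg (w := w)
  rw [translationLength, div_pow, Real.sq_sqrt (by nlinarith)]
  ring

lemma translationLength_nonneg : 0 ≤ translationLength w := by
  have h0 := stepLimit_nonneg (w := w)
  unfold translationLength
  positivity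

/-- Solve `d² = X / (X + 4 y y')` for the squared Euclidean step: `X = 4 y y' d² / (1 - d²)`. -/
lemma IsBISBS.tendsto_norm_sub_sq (hw : IsBISBS φ w) (hφ : IsParabolicSelfMap φ)
    (him : Tendsto (fun n => (w n).im) atTop (𝓝 ℓ)) :
    Tendsto (fun n => ‖w (n + 1) - w n‖ ^ 2) atTop (𝓝 ((translationLength w * ℓ) ^ 2)) := by
  have h1 := hw.stepLimit_lt_one
  have h0 := stepLimit_nonneg (w := w)
  have hd := (hw.tendsto_step hφ).pow 2
  have hne : 1 - stepLimit w ^ 2 ≠ 0 := by nlinarith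
  have him' : Tendsto (fun n => (w (n + 1)).im) atTop (𝓝 ℓ) :=
    him.comp (tendsto_add_atTop_nat 1)
  have h := ((hd.const_mul 4).div (hd.const_sub 1) hne).mul (him'.mul him)
  rw [← translationLength_sq hw] at h
  have he : translationLength w ^ 2 * (ℓ * ℓ) = (translationLength w * ℓ) ^ 2 := by ring
  rw [he] at h
  refine h.congr fun n => ?_
  have hy : 0 < (w n).im := hw.mem n
  have hy' : 0 < (w (n + 1)).im := hw.mem (n + 1)
  rw [Pi.div_apply, pseudoHypDist_sq]
  have hX : 0 ≤ ‖w (n + 1) - w n‖ ^ 2 := by positivity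
  generalize ‖w (n + 1) - w n‖ ^ 2 = X at *
  have hS : 0 < X + 4 * ((w (n + 1)).im * (w n).im) := by positivity
  have h2 : 1 - X / (X + 4 * ((w (n + 1)).im * (w n).im)) =
      4 * ((w (n + 1)).im * (w n).im) / (X + 4 * ((w (n + 1)).im * (w n).im)) := by
    rw [eq_div_iff hS.ne', sub_mul, div_mul_cancel₀ _ hS.ne']
    ring
  rw [h2]
  field_simp

lemma norm_sub_sq_eq (z w : ℂ) : ‖z - w‖ ^ 2 = (z.re - w.re) ^ 2 + (z.im - w.im) ^ 2 := by
  rw [Complex.sq_norm, Complex.normSq_apply, Complex.sub_re, Complex.sub_im]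
  ring

/-- The horizontal steps converge to the translation length times the limiting height, and this
limit is positive. -/
theorem IsBISBS.tendsto_re_step (hw : IsBISBS φ w) (hφ : IsParabolicSelfMap φ) (hℓ : 0 < ℓ)
    (him : Tendsto (fun n => (w n).im) atTop (𝓝 ℓ))
    (hre : Tendsto (fun n => (w n).re) atTop atTop) :
    0 < translationLength w ∧
      Tendsto (fun n => (w (n + 1)).re - (w n).re) atTop (𝓝 (translationLength w * ℓ)) := by
  set B := translationLength w * ℓ with hBdef
  have hB : 0 ≤ B := mul_nonneg translationLength_nonneg hℓ.le
  have hy : ∀ n, 0 < (w n).im := hw.mem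
  have him1 : Tendsto (fun n => (w (n + 1)).im) atTop (𝓝 ℓ) :=
    him.comp (tendsto_add_atTop_nat 1)
  have him2 : Tendsto (fun n => (w (n + 2)).im) atTop (𝓝 ℓ) :=
    him.comp (tendsto_add_atTop_nat 2)
  set s : ℕ → ℝ := fun n => (w (n + 1)).re - (w n).re with hs
  have hsq : Tendsto (fun n => s n ^ 2) atTop (𝓝 (B ^ 2)) := by
    have h := (hw.tendsto_norm_sub_sq hφ him).sub ((him1.sub him).pow 2)
    simp only [norm_sub_sq_eq, sub_self, add_sub_cancel_right] at h
    simpa using h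
  have hsq1 : Tendsto (fun n => s (n + 1) ^ 2) atTop (𝓝 (B ^ 2)) :=
    hsq.comp (tendsto_add_atTop_nat 1)
  -- The two-step distance, as a Schwarz–Pick monotone quantity. Its limit determines that of `s n *
  -- s (n + 1)`, hence whether consecutive steps agree in sign.
  set σ : ℕ → ℝ := fun n => ‖w n - w (n + 2)‖ ^ 2 / ((w n).im * (w (n + 2)).im) with hσ
  have hσ_eq : ∀ n, σ n * ((w n).im * (w (n + 2)).im) = ‖w n - w (n + 2)‖ ^ 2 := fun n =>
    div_mul_cancel₀ _ (mul_pos (hy _) (hy _)).ne'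
  have hσ_exp : ∀ n, ‖w n - w (n + 2)‖ ^ 2 =
      (s n + s (n + 1)) ^ 2 + ((w n).im - (w (n + 2)).im) ^ 2 := fun n => by
    rw [norm_sub_sq_eq]
    simp only [hs]
    ring
  have hσ0 : ∀ n, 0 ≤ σ n := fun n =>
    div_nonneg (by positivity) (mul_pos (hy _) (hy _)).le
  have hmono : Monotone σ := monotone_nat_of_le_succ fun n => by
    have := schwarz_pick_of_mapsTo hφ.analytic hφ.mapsTo (hw.mem (n + 1)) (hw.mem (n + 2 + 1))
    rw [hw.backward, hw.backward] at this
    rw [hσ, div_le_div_iff₀ (mul_pos (hy _) (hy _)) (mul_pos (hy _) (hy _))]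
    exact this
  have hyy : Tendsto (fun n => (w n).im * (w (n + 2)).im) atTop (𝓝 (ℓ * ℓ)) := him.mul him2
  obtain ⟨c, hc⟩ : ∃ c, Tendsto σ atTop (𝓝 c) := by
    refine (tendsto_atTop_of_monotone hmono).resolve_left fun htop => ?_
    have hub : Tendsto (fun n => (2 * s n ^ 2 + 2 * s (n + 1) ^ 2 +
        ((w n).im - (w (n + 2)).im) ^ 2) / ((w n).im * (w (n + 2)).im)) atTop
        (𝓝 ((2 * B ^ 2 + 2 * B ^ 2 + (ℓ - ℓ) ^ 2) / (ℓ * ℓ))) :=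
      (((hsq.const_mul 2).add (hsq1.const_mul 2)).add ((him.sub him2).pow 2)).div hyy
        (mul_pos hℓ hℓ).ne'
    refine not_tendsto_nhds_of_tendsto_atTop (tendsto_atTop_mono (fun n => ?_) htop) _ hub
    show ‖w n - w (n + 2)‖ ^ 2 / _ ≤ _
    rw [hσ_exp]
    refine div_le_div_of_nonneg_right ?_ (mul_pos (hy _) (hy _)).le
    nlinarith [sq_nonneg (s n - s (n + 1))]
  have hP : Tendsto (fun n => s n * s (n + 1)) atTop (𝓝 ((c * (ℓ * ℓ) - 2 * B ^ 2) / 2)) := by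
    have h := (((((hc.mul hyy).sub ((him.sub him2).pow 2)).sub hsq).sub hsq1).div_const 2)
    have e : (c * (ℓ * ℓ) - (ℓ - ℓ) ^ 2 - B ^ 2 - B ^ 2) / 2 = (c * (ℓ * ℓ) - 2 * B ^ 2) / 2 := by
      ring
    rw [e] at h
    refine h.congr fun n => ?_
    rw [hσ_eq, hσ_exp]
    ring
  have hPsq : ((c * (ℓ * ℓ) - 2 * B ^ 2) / 2) ^ 2 = B ^ 2 * B ^ 2 :=
    tendsto_nhds_unique (hP.pow 2) ((hsq.mul hsq1).congr fun n => by ring)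
  -- A nondecreasing nonnegative `σ` with limit `0` vanishes, so `w` would have period two, against
  -- `hre`.
  have hc0 : c ≠ 0 := by
    rintro rfl
    have hz : ∀ n, w (n + 2) = w n := by
      intro n
      have h1 : σ n = 0 := le_antisymm (hmono.ge_of_tendsto hc n) (hσ0 n)
      have h2 := hσ_eq n
      rw [h1, zero_mul] at h2
      have h3 : ‖w n - w (n + 2)‖ = 0 := pow_eq_zero_iff two_ne_zero |>.1 h2.symm
      exact (sub_eq_zero.1 (norm_eq_zero.1 h3)).symm
    have hper : ∀ k, w (2 * k) = w 0 := by
      intro k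
      induction k with
      | zero => rfl
      | succ k ih => rw [mul_add, mul_one, hz, ih]
    have htop : Tendsto (fun k => (w (2 * k)).re) atTop atTop :=
      hre.comp (tendsto_id.const_mul_atTop' two_pos)
    simp only [hper] at htop
    exact not_tendsto_const_atTop _ _ htop
  -- This expands `hPsq`: either `c = 0` (steps cancelling in pairs) or `c ℓ² = 4 B²` (steps adding
  -- up).
  have hprod : c * (ℓ * ℓ) * (c * (ℓ * ℓ) - 4 * B ^ 2) = 0 := by nlinarith
  have hcl : c * (ℓ * ℓ) ≠ 0 := mul_ne_zero hc0 (mul_pos hℓ hℓ).ne'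
  have hceq : c * (ℓ * ℓ) = 4 * B ^ 2 := by
    rcases mul_eq_zero.1 hprod with h | h
    · exact absurd h hcl
    · linarith
  have hBpos : 0 < B := by
    refine lt_of_le_of_ne hB fun h => hcl ?_
    rw [hceq, ← h]
    ring
  refine ⟨(mul_pos_iff_of_pos_right hℓ).1 hBpos, ?_⟩
  refine tendsto_of_sq_of_mul_succ (fun _ => rfl) hre hB hsq (hP.eventually (lt_mem_nhds ?_))
  rw [hceq]
  nlinarith [pow_pos hBpos 2]

end BackwardIteration

/-! ### Affine normalizations -/

/-- The inverse of `normalizer p`. -/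
noncomputable def denormalizer (p z : ℂ) : ℂ := (z - (p.re : ℂ)) / (p.im : ℂ)

section normalizer

variable {p z : ℂ}

lemma normalizer_im : (normalizer p z).im = p.im * z.im := by
  simp [normalizer]

lemma denormalizer_im : (denormalizer p z).im = z.im / p.im := by
  rw [denormalizer, Complex.div_ofReal_im]
  simp

lemma normalizer_I : normalizer p Complex.I = p := by
  simp [normalizer, Complex.re_add_im]

lemma normalizer_denormalizer (hp : p ∈ upperHalf) : normalizer p (denormalizer p z) = z := by
  have : (p.im : ℂ) ≠ 0 := by exact_mod_cast (show 0 < p.im from hp).ne'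
  rw [normalizer, denormalizer]
  field_simp
  ring

lemma denormalizer_normalizer (hp : p ∈ upperHalf) : denormalizer p (normalizer p z) = z := by
  have : (p.im : ℂ) ≠ 0 := by exact_mod_cast (show 0 < p.im from hp).ne'
  rw [normalizer, denormalizer]
  field_simp
  ring

lemma mapsTo_normalizer (hp : p ∈ upperHalf) : MapsTo (normalizer p) upperHalf upperHalf :=
  fun z hz => by
    show 0 < (normalizer p z).im
    rw [normalizer_im]
    exact mul_pos hp hz

lemma mapsTo_denormalizer (hp : p ∈ upperHalf) : MapsTo (denormalizer p) upperHalf upperHalf :=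
  fun z hz => by
    show 0 < (denormalizer p z).im
    rw [denormalizer_im]
    exact div_pos hz hp

lemma differentiable_normalizer : Differentiable ℂ (normalizer p) := by
  unfold normalizer
  fun_prop

lemma differentiable_denormalizer : Differentiable ℂ (denormalizer p) := by
  unfold denormalizer
  fun_prop

end normalizer

/-! ### The conjugating map -/

section BackwardIteration

variable {φ : ℂ → ℂ} {w : ℕ → ℂ} {ℓ : ℝ}

lemma IsParabolicSelfMap.differentiableOn_iterate (hφ : IsParabolicSelfMap φ) (n : ℕ) :
    DifferentiableOn ℂ φ^[n] upperHalf := by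
  induction n with
  | zero => exact differentiableOn_id
  | succ n ih => exact ih.comp hφ.analytic hφ.mapsTo

lemma IsParabolicSelfMap.im_le_im_iterate (hφ : IsParabolicSelfMap φ) (n : ℕ) {z : ℂ}
    (hz : z ∈ upperHalf) : z.im ≤ (φ^[n] z).im := by
  induction n with
  | zero => exact le_rfl
  | succ n ih =>
    rw [Function.iterate_succ_apply']
    exact ih.trans (hφ.im_le_im (hφ.mapsTo.iterate n hz))

lemma IsBISBS.iterate_apply (hw : IsBISBS φ w) (n k : ℕ) : φ^[k] (w (n + k)) = w n := by
  induction k with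
  | zero => rfl
  | succ k ih => rw [Function.iterate_succ_apply, ← add_assoc, hw.backward, ih]

/-- The points of the sequence, normalized at the `n`-th one, form in the limit an orbit of the
translation by `translationLength w`. -/
lemma IsBISBS.tendsto_denormalizer (hw : IsBISBS φ w) (hφ : IsParabolicSelfMap φ) (hℓ : 0 < ℓ)
    (him : Tendsto (fun n => (w n).im) atTop (𝓝 ℓ))
    (hre : Tendsto (fun n => (w n).re) atTop atTop) (k : ℕ) :
    Tendsto (fun n => denormalizer (w n) (w (n + k))) atTop
      (𝓝 (k * translationLength w + Complex.I)) := by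
  have hstep := (hw.tendsto_re_step hφ hℓ him hre).2
  have hdiff : Tendsto (fun n => (w (n + k)).re - (w n).re) atTop
      (𝓝 (k * (translationLength w * ℓ))) := by
    induction k with
    | zero => simp
    | succ k ih =>
      have := (hstep.comp (tendsto_add_atTop_nat k)).add ih
      convert this using 1
      · ext n
        simp only [Function.comp, add_assoc]
        ring
      · push_cast
        ring_nf
  have him' : Tendsto (fun n => (w (n + k)).im) atTop (𝓝 ℓ) :=
    him.comp (tendsto_add_atTop_nat k)
  have h1 := hdiff.div him hℓ.ne'
  have h2 := him'.div him hℓ.ne'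
  have h := ((Complex.continuous_ofReal.tendsto _).comp h1).add
    (((Complex.continuous_ofReal.tendsto _).comp h2).mul_const Complex.I)
  have e1 : (k : ℝ) * (translationLength w * ℓ) / ℓ = k * translationLength w := by
    field_simp
  rw [e1, div_self hℓ.ne'] at h
  simp only [Complex.ofReal_mul, Complex.ofReal_natCast, Complex.ofReal_one, one_mul] at h
  refine h.congr fun n => ?_
  have : ((w n).im : ℂ) ≠ 0 := by exact_mod_cast (show 0 < (w n).im from hw.mem n).ne'
  simp only [Function.comp, Pi.div_apply, denormalizer, Complex.ofReal_div, Complex.ofReal_sub]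
  linear_combination (Complex.re_add_im (w (n + k))) / ((w n).im : ℂ)

/-- The normalized iterates converge locally uniformly. -/
theorem IsBISBS.exists_limit (hw : IsBISBS φ w) (hφ : IsParabolicSelfMap φ) (hℓ : 0 < ℓ)
    (him : Tendsto (fun n => (w n).im) atTop (𝓝 ℓ))
    (hre : Tendsto (fun n => (w n).re) atTop atTop) :
    ∃ ψ : ℂ → ℂ, TendstoLocallyUniformlyOn (fun (n : ℕ) (z : ℂ) => φ^[n] (normalizer (w n) z)) ψ
      atTop upperHalf := by
  have hb := (hw.tendsto_re_step hφ hℓ him hre).1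
  refine exists_tendstoLocallyUniformlyOn
    (G := fun n m z => denormalizer (w n) (φ^[m - n] (normalizer (w m) z)))
    (q := fun n => denormalizer (w n) (w (n + 1)))
    (q₀ := (1 : ℕ) * translationLength w + Complex.I)
    (fun n => (hφ.differentiableOn_iterate n).comp differentiable_normalizer.differentiableOn
      (mapsTo_normalizer (hw.mem n)))
    (fun n => (hφ.mapsTo.iterate n).comp (mapsTo_normalizer (hw.mem n)))
    (fun n m _ => differentiable_denormalizer.comp_differentiableOn
      ((hφ.differentiableOn_iterate (m - n)).comp differentiable_normalizer.differentiableOn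
        (mapsTo_normalizer (hw.mem m))))
    (fun n m _ => (mapsTo_denormalizer (hw.mem n)).comp
      ((hφ.mapsTo.iterate (m - n)).comp (mapsTo_normalizer (hw.mem m))))
    (fun n m hnm => ?_) (fun n m hnm z _ => ?_) (fun n m hnm => ?_)
    (fun n => mapsTo_denormalizer (hw.mem n) (hw.mem _)) ?_ ?_
    (hw.tendsto_denormalizer hφ hℓ him hre 1)
  · obtain ⟨k, rfl⟩ := Nat.exists_eq_add_of_le hnm
    rw [normalizer_I, Nat.add_sub_cancel_left, hw.iterate_apply]
    nth_rewrite 2 [← normalizer_I (p := w n)]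
    exact denormalizer_normalizer (hw.mem n)
  · rw [normalizer_denormalizer (hw.mem n), ← Function.iterate_add_apply, Nat.add_sub_cancel' hnm]
  · obtain ⟨k, rfl⟩ := Nat.exists_eq_add_of_le hnm
    rw [normalizer_denormalizer (hw.mem _), Nat.add_sub_cancel_left, add_right_comm,
      hw.iterate_apply]
  · simp [upperHalf]
  -- The limit `b₀ + i` of `q` differs from `i` exactly because `b₀ > 0`.
  · intro h
    have := congrArg Complex.re h
    simp at this
    exact hb.ne' this

variable {ψ : ℂ → ℂ}

/-- Julia's lemma iterated, then passed to the limit. It keeps `ψ` inside the open half-plane and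
makes `ψ z - ℓ z` eligible for the injectivity criterion. -/
lemma IsBISBS.mul_im_le_of_limit (hw : IsBISBS φ w) (hφ : IsParabolicSelfMap φ)
    (him : Tendsto (fun n => (w n).im) atTop (𝓝 ℓ))
    (hlim : TendstoLocallyUniformlyOn (fun (n : ℕ) (z : ℂ) => φ^[n] (normalizer (w n) z)) ψ
      atTop upperHalf) {z : ℂ} (hz : z ∈ upperHalf) : ℓ * z.im ≤ (ψ z).im := by
  refine le_of_tendsto_of_tendsto' (him.mul_const z.im)
    ((Complex.continuous_im.tendsto _).comp (hlim.tendsto_at hz)) fun n => ?_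
  rw [← normalizer_im]
  exact hφ.im_le_im_iterate n (mapsTo_normalizer (hw.mem n) hz)

/-- The limit of the normalized iterates is a conjugating map. -/
theorem IsBISBS.isConjugatingMap (hw : IsBISBS φ w) (hφ : IsParabolicSelfMap φ) (hℓ : 0 < ℓ)
    (him : Tendsto (fun n => (w n).im) atTop (𝓝 ℓ))
    (hre : Tendsto (fun n => (w n).re) atTop atTop)
    (hlim : TendstoLocallyUniformlyOn (fun (n : ℕ) (z : ℂ) => φ^[n] (normalizer (w n) z)) ψ
      atTop upperHalf) : IsConjugatingMap φ w ψ := by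
  have hdiff : DifferentiableOn ℂ ψ upperHalf :=
    hlim.differentiableOn (Eventually.of_forall fun n =>
      (hφ.differentiableOn_iterate n).comp differentiable_normalizer.differentiableOn
        (mapsTo_normalizer (hw.mem n))) upperHalf_isOpen
  have hmaps : MapsTo ψ upperHalf upperHalf := fun z hz =>
    (mul_pos hℓ hz).trans_le (hw.mul_im_le_of_limit hφ him hlim hz)
  refine ⟨hdiff, hmaps, hlim, fun z hz => ?_⟩
  have hzb : z - (translationLength w : ℂ) ∈ upperHalf := by
    simpa [upperHalf] using hz
  have h1 : Tendsto (fun n => φ (φ^[n] (normalizer (w n) z))) atTop (𝓝 (φ (ψ z))) :=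
    (hφ.analytic.continuousOn.continuousAt
      (upperHalf_isOpen.mem_nhds (hmaps hz))).tendsto.comp (hlim.tendsto_at hz)
  -- `g n = τ_{n+1}⁻¹ (τ_n z)` tends to `z - b₀`, while `φ_{n+1} (τ_{n+1} (g n)) = φ (φ_n (τ_n z))`;
  -- the two limits of this quantity give the functional equation.
  set g : ℕ → ℂ := fun n => denormalizer (w (n + 1)) (normalizer (w n) z) with hg
  have hgm : ∀ n, g n ∈ upperHalf := fun n =>
    mapsTo_denormalizer (hw.mem _) (mapsTo_normalizer (hw.mem n) hz)
  have hglim : Tendsto g atTop (𝓝 (z - (translationLength w : ℂ))) := by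
    have him1 : Tendsto (fun n => (w (n + 1)).im) atTop (𝓝 ℓ) :=
      him.comp (tendsto_add_atTop_nat 1)
    have hstep := (hw.tendsto_re_step hφ hℓ him hre).2
    have ha := (Complex.continuous_ofReal.tendsto _).comp (him.div him1 hℓ.ne')
    have hb := (Complex.continuous_ofReal.tendsto _).comp (hstep.div him1 hℓ.ne')
    have h := (ha.mul_const z).sub hb
    rw [mul_div_cancel_right₀ _ hℓ.ne', div_self hℓ.ne', Complex.ofReal_one, one_mul] at h
    refine h.congr fun n => ?_
    simp only [Function.comp, Pi.div_apply, hg, denormalizer, normalizer, Complex.ofReal_div,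
      Complex.ofReal_sub]
    ring
  have h2 : Tendsto (fun n => φ^[n + 1] (normalizer (w (n + 1)) (g n))) atTop
      (𝓝 (ψ (z - (translationLength w : ℂ)))) := by
    have hlim' : TendstoLocallyUniformlyOn
        (fun (n : ℕ) (z : ℂ) => φ^[n + 1] (normalizer (w (n + 1)) z)) ψ atTop upperHalf :=
      fun u hu x hx => by
        obtain ⟨t, ht, h⟩ := hlim u hu x hx
        exact ⟨t, ht, (tendsto_add_atTop_nat 1).eventually h⟩
    exact hlim'.tendsto_comp (hdiff.continuousOn _ hzb) hzb
      (tendsto_nhdsWithin_iff.2 ⟨hglim, Eventually.of_forall hgm⟩)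
  refine tendsto_nhds_unique h2 (h1.congr fun n => ?_)
  rw [hg, normalizer_denormalizer (hw.mem _), Function.iterate_succ_apply']

/-- The conjugating map interpolates the backward-iteration sequence. -/
lemma IsBISBS.limit_apply (hw : IsBISBS φ w) (hφ : IsParabolicSelfMap φ) (hℓ : 0 < ℓ)
    (him : Tendsto (fun n => (w n).im) atTop (𝓝 ℓ))
    (hre : Tendsto (fun n => (w n).re) atTop atTop) (hψ : IsConjugatingMap φ w ψ) (k : ℕ) :
    ψ (k * translationLength w + Complex.I) = w k := by
  have hmem : (k * translationLength w + Complex.I : ℂ) ∈ upperHalf := by simp [upperHalf]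
  have h := hψ.limit.tendsto_comp (hψ.analytic.continuousOn _ hmem) hmem
    (tendsto_nhdsWithin_iff.2 ⟨hw.tendsto_denormalizer hφ hℓ him hre k,
      Eventually.of_forall fun n => mapsTo_denormalizer (hw.mem n) (hw.mem _)⟩)
  refine tendsto_nhds_unique h (tendsto_const_nhds.congr fun n => ?_)
  rw [normalizer_denormalizer (hw.mem n), add_comm n k, hw.iterate_apply]

/-! ### Injectivity of `ψ` and `φ` -/

theorem IsBISBS.eventually_injOn_conjugatingMap (hw : IsBISBS φ w) (hφ : IsParabolicSelfMap φ)
    (hℓ : 0 < ℓ) (him : Tendsto (fun n => (w n).im) atTop (𝓝 ℓ))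
    (hre : Tendsto (fun n => (w n).re) atTop atTop) (hψ : IsConjugatingMap φ w ψ) :
    ∀ᶠ R : ℝ in atTop, InjOn ψ (quadrant R) := by
  have hb := (hw.tendsto_re_step hφ hℓ him hre).1
  -- At `k b₀ + i` the map `ψ` takes the value `w k`, so there `p` has imaginary part `y_k - ℓ → 0`.
  refine eventually_injOn_quadrant (p := fun z => ψ z - ℓ * z) (c := ℓ) (ℓ := 1)
    (B := translationLength w) (u := fun k => k * translationLength w + Complex.I) hℓ
    (fun z _ => by ring) (hψ.analytic.sub (differentiableOn_id.const_mul _)) (fun z hz => ?_)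
    (fun n => by simp [upperHalf]) one_pos ?_ ?_ (fun n => ?_) ?_
  · have := hw.mul_im_le_of_limit hφ him hψ.limit hz
    simpa using this
  · simp
  · simpa using tendsto_natCast_atTop_atTop.atTop_mul_const hb
  · simp [add_mul, abs_of_pos hb]
  · simp only [hw.limit_apply hφ hℓ him hre hψ]
    simpa using him.sub_const ℓ

theorem IsBISBS.eventually_injOn (hw : IsBISBS φ w) (hφ : IsParabolicSelfMap φ)
    (hℓ : 0 < ℓ) (him : Tendsto (fun n => (w n).im) atTop (𝓝 ℓ))
    (hre : Tendsto (fun n => (w n).re) atTop atTop) :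
    ∀ᶠ R : ℝ in atTop, InjOn φ (quadrant R) := by
  have hstep := (hw.tendsto_re_step hφ hℓ him hre).2
  obtain ⟨B, hB⟩ := (hstep.comp (tendsto_add_atTop_nat 1)).abs.bddAbove_range
  have him1 : Tendsto (fun n => (w (n + 1)).im) atTop (𝓝 ℓ) :=
    him.comp (tendsto_add_atTop_nat 1)
  -- The shift makes `φ (w (n + 1)) = w n` available: at these points `p` has imaginary part `y_n -
  -- y_{n+1} → 0`.
  refine eventually_injOn_quadrant (p := fun z => φ z - z) (c := 1) (ℓ := ℓ) (B := B)
    (u := fun n => w (n + 1)) one_pos (fun z _ => by simp)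
    (hφ.analytic.sub differentiableOn_id) (fun z hz => ?_) (fun n => hw.mem _) hℓ him1
    (hre.comp (tendsto_add_atTop_nat 1)) (fun n => hB ⟨n, rfl⟩) ?_
  · simpa using hφ.im_le_im hz
  · simpa [hw.backward] using him.sub him1

end BackwardIteration

theorem corollary1p16 (φ : ℂ → ℂ) (hφ : IsParabolicSelfMap φ)
    (w : ℕ → ℂ) (hw : IsBISBS φ w)
    (ℓ : ℝ) (hℓ : 0 < ℓ) (him : Tendsto (fun n => (w n).im) atTop (𝓝 ℓ))
    (hre : Tendsto (fun n => (w n).re) atTop atTop) :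
    (∃ ψ : ℂ → ℂ, IsConjugatingMap φ w ψ ∧ ∀ᶠ R : ℝ in atTop, InjOn ψ (quadrant R)) ∧
      ∀ᶠ R : ℝ in atTop, InjOn φ (quadrant R) := by
  obtain ⟨ψ, hlim⟩ := hw.exists_limit hφ hℓ him hre
  have hψ := hw.isConjugatingMap hφ hℓ him hre hlim
  exact ⟨⟨ψ, hψ, hw.eventually_injOn_conjugatingMap hφ hℓ him hre hψ⟩,
    hw.eventually_injOn hφ hℓ him hre⟩
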